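/- Hypergraphs are finite and may have repeated edges; $|\mathcal H|$ is the number of edges counted with multiplicity, and $d(A)$ is the number of edges containing a vertex set $A$. For reals $0<q_1,\dots,q_n\le 1$ and integers $r_1>\dots>r_{n+1}\ge 1$, a hypergraph $\mathcal H$ on a finite vertex set $V$ is called $(q_1,\dots,q_n;r_1,\dots,r_{n+1})$-spread if it has at least one edge, every edge has size at most $r_1$, and for every $1\le i\le n$, every $A\subseteq V$ with $d(A)>0$ and $r_i\ge |A|\ge r_{i+1}$, and every integer $j\ge r_{i+1}$, \[ |\{S\in\mathcal H: |A\cap S|\ge j\}|\le q_i^{\,j}\,|\mathcal H| . \] Theorem. For every real $K$ there is a constant $K_0>0$, depending only on $K$, such that the following holds. Let $\ell\ge 1$, let $\mathcal H$ be a $(q_1,\dots,q_\ell;r_1,\dots,r_\ell,1)$-spread hypergraph on $V$, and let $s=\min_{S\in\mathcal H}|S|$. Assume that $r_i\le Kq_i|V|$ for all $1\le i\le \ell$, that $\log r_i\le K r_{i+1}$ for all $1\le i<\ell$ with $r_i>s$, and that $r_\ell\le\max\{s,\,K_0\log(\ell+1)\}$. Let $C\ge K_0$ be a real number with $C\sum_{i=1}^\ell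 q_i\le 1$, and let $W$ be chosen uniformly at random among the subsets of $V$ of size $C\sum_{i=1}^{\ell}q_i\,|V|$ (rounded up to an integer). Then \[ \Pr[W\text{ contains an edge of }\mathcal H]\ \ge\ 1-\frac{K_0\log(\ell+1)}{C L},\qquad L:=\frac{\sum_{i=1}^{\ell} q_i}{\max_{1\le i\le \ell} q_i}. \] -/

import Mathlib

/-- A finite hypergraph on the vertex set `V`, repeated edges allowed: the multiset of its edges.
The number of edges `|H|` is `Multiset.card H`, counted with multiplicity. -/
abbrev MultiHypergraph (V : Type*) := Multiset (Finset V)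

namespace MultiHypergraph

/-- The minimum size of an edge (of a hypergraph with at least one edge). -/
noncomputable def minEdgeSize {V : Type*} (H : MultiHypergraph V) : ℕ :=
  sInf {k : ℕ | ∃ S ∈ H, S.card = k}

variable {V : Type*} [DecidableEq V]

/-- The degree `d(A)`: the number of edges containing `A`. -/
def degree (H : MultiHypergraph V) (A : Finset V) : ℕ :=
  Multiset.card (Multiset.filter (fun S => A ⊆ S) H)

/-- `M_j(A)`: the number of edges meeting `A` in at least `j` vertices. -/
def meetCount (H : MultiHypergraph V) (j : ℕ) (A : Finset V) : ℕ :=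
  Multiset.card (Multiset.filter (fun S => j ≤ (A ∩ S).card) H)

/-- `H` is `(q₁, …, qₙ; r₁, …, rₙ, rₙ₊₁)`-spread. Only the values `q i` for `1 ≤ i ≤ n` and
`r i` for `1 ≤ i ≤ n + 1` are used. -/
structure IsSpread (H : MultiHypergraph V) (n : ℕ) (q : ℕ → ℝ) (r : ℕ → ℕ) : Prop where
  q_pos : ∀ i, 1 ≤ i → i ≤ n → 0 < q i
  q_le_one : ∀ i, 1 ≤ i → i ≤ n → q i ≤ 1
  r_pos : ∀ i, 1 ≤ i → i ≤ n + 1 → 0 < r i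
  r_strictAnti : ∀ i, 1 ≤ i → i ≤ n → r (i + 1) < r i
  nonempty : H ≠ 0
  bounded : ∀ S ∈ H, S.card ≤ r 1
  spread : ∀ i, 1 ≤ i → i ≤ n → ∀ A : Finset V, 0 < H.degree A →
    A.card ≤ r i → r (i + 1) ≤ A.card →
    ∀ j : ℕ, r (i + 1) ≤ j → (H.meetCount j A : ℝ) ≤ q i ^ j * (Multiset.card H : ℝ)

/-- The probability that a set `W` chosen uniformly at random among the `m`-element subsets of `V`
contains an edge of `H` (meaningful for `m ≤ |V|`, when such subsets exist). -/
noncomputable def probContainsEdge [Fintype V] (H : MultiHypergraph V) (m : ℕ) : ℝ :=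
  ((((Finset.univ : Finset V).powersetCard m).filter (fun W => ∃ S ∈ H, S ⊆ W)).card : ℝ) /
    (((Finset.univ : Finset V).powersetCard m).card : ℝ)

end MultiHypergraph

/-! Reveal the random set in `ℓ` disjoint pieces. Given a piece `W`, replace each edge by a minimal
fragment `T` outside `W`: some edge lies in `Z = W ∪ T`, and every edge in `Z` contains `T`. Once
`Z` is known, `T` is a subset of any fixed edge `A ⊆ Z`, so fragments of size `t` cost only the sum
of the binomials `|S ∩ A|` over `t`, while the sets `Z` outnumber the sets `W` by at most `x ^ t`,
`x` of order `|V| / |W|`. Spreadness makes the binomial sum at most about `(2q)^t |H|`, so large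
fragments are rare (`exists_fragments`).

Stage `j` discards fragments larger than `max (r (j+1)) k`, where `k` is `log (ℓ+1)` rounded up.
Discarded edges are counted against the original `H`, so the losses of the stages add up
(`card_fail_mul_card_le`). The floor `k` makes every early loss `O(1/(C ℓ²))`, in total `O(1/(C
ℓ))`, and `L ≤ ℓ`. The last stage receives about half of the random set and must leave only empty
fragments; its loss is `O(log (ℓ+1) / (C L))`, by spreadness or, if `r ℓ < k`, by the degree bound
`IsSpread.degree_le`. -/

namespace MultiHypergraph

/-! ### Minimal fragments and how many of them are large -/

/-- Relative to a set `W`, every edge `F i` of a family contains a set `T`, disjoint from `W`, such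
that some edge lies in `W ∪ T` and every edge in `W ∪ T` contains `T`. -/
theorem exists_minimal_fragment {V ι : Type*} [DecidableEq V] (I : Finset ι) (F : ι → Finset V)
    (W : Finset V) (i : ι) (hi : i ∈ I) :
    ∃ T, T ⊆ F i ∧ Disjoint T W ∧ (∃ j ∈ I, T = F j \ W) ∧
      ∀ j ∈ I, F j ⊆ W ∪ T → T ⊆ F j := by
  classical
  obtain ⟨k, hk, hmin⟩ := Finset.exists_min_image (I.filter fun j => F j ⊆ W ∪ F i)
    (fun j => (F j \ W).card) ⟨i, Finset.mem_filter.2 ⟨hi, Finset.subset_union_right⟩⟩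
  rw [Finset.mem_filter] at hk
  have hsub : F k \ W ⊆ F i := sdiff_le_iff.2 hk.2
  refine ⟨F k \ W, hsub, Finset.sdiff_disjoint, ⟨k, hk.1, rfl⟩, fun j hj hjT => ?_⟩
  have h1 : F j \ W ⊆ F k \ W := sdiff_le_iff.2 hjT
  have h2 := hmin j (Finset.mem_filter.2 ⟨hj, hjT.trans (Finset.union_subset_union_right hsub)⟩)
  rw [← Finset.eq_of_subset_of_card_le h1 h2]
  exact Finset.sdiff_subset

/-- Encode `(W, i)` as `(W ∪ T, i, T)`. This is injective, since `W = (W ∪ T) \ T`, and by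
minimality `T` is a `t`-subset of `F i ∩ g Z`, where the edge `g Z ⊆ Z` depends on `Z = W ∪ T`
alone. -/
theorem sum_card_fragment_eq_le {V ι : Type*} [DecidableEq V] (I : Finset ι) (F : ι → Finset V)
    (U : Finset V) (w t : ℕ) (B : ℝ) (T : Finset V → ι → Finset V)
    (hFU : ∀ i ∈ I, F i ⊆ U)
    (hTF : ∀ W, ∀ i ∈ I, T W i ⊆ F i) (hTW : ∀ W, ∀ i ∈ I, Disjoint (T W i) W)
    (hT : ∀ W, ∀ i ∈ I, ∃ j ∈ I, T W i = F j \ W)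
    (hmin : ∀ W, ∀ i ∈ I, ∀ j ∈ I, F j ⊆ W ∪ T W i → T W i ⊆ F j)
    (hB0 : 0 ≤ B)
    (hB : ∀ j ∈ I, t ≤ (F j).card → ∑ i ∈ I, ((F i ∩ F j).card.choose t : ℝ) ≤ B) :
    ∑ W ∈ U.powersetCard w, ((I.filter fun i => (T W i).card = t).card : ℝ) ≤
      (U.card.choose (w + t) : ℝ) * B := by
  classical
  have hg : ∀ Z : Finset V, ∃ A : Finset V, (∃ j ∈ I, F j ⊆ Z ∧ t ≤ (F j).card) →
      ∃ j ∈ I, F j ⊆ Z ∧ t ≤ (F j).card ∧ A = F j := by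
    intro Z
    by_cases h : ∃ j ∈ I, F j ⊆ Z ∧ t ≤ (F j).card
    · obtain ⟨j, hj, hjZ, hjt⟩ := h
      exact ⟨F j, fun _ => ⟨j, hj, hjZ, hjt, rfl⟩⟩
    · exact ⟨∅, fun h' => absurd h' h⟩
  choose g hg using hg
  set Zs := (U.powersetCard (w + t)).filter fun Z => ∃ j ∈ I, F j ⊆ Z ∧ t ≤ (F j).card with hZs
  have hinj : ((U.powersetCard w).sigma fun W => I.filter fun i => (T W i).card = t).card ≤
      (Zs.sigma fun Z => I.sigma fun i => (F i ∩ g Z).powersetCard t).card := by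
    refine Finset.card_le_card_of_injOn
      (fun p => ⟨p.1 ∪ T p.1 p.2, ⟨p.2, T p.1 p.2⟩⟩) ?_ ?_
    · rintro ⟨W, i⟩ h
      simp only [Finset.coe_sigma, Set.mem_sigma_iff, Finset.mem_coe, Finset.mem_powersetCard,
        Finset.mem_filter] at h
      obtain ⟨⟨hWU, hWw⟩, hi, hit⟩ := h
      obtain ⟨j, hj, hjT⟩ := hT W i hi
      have hjZ : F j ⊆ W ∪ T W i := by rw [hjT]; simp
      have hjt : t ≤ (F j).card := by
        rw [← hit, hjT]; exact Finset.card_le_card Finset.sdiff_subset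
      have hex : ∃ j ∈ I, F j ⊆ W ∪ T W i ∧ t ≤ (F j).card := ⟨j, hj, hjZ, hjt⟩
      obtain ⟨j', hj', hj'Z, -, hA⟩ := hg _ hex
      simp only [Finset.coe_sigma, Set.mem_sigma_iff, Finset.mem_coe, hZs, Finset.mem_filter,
        Finset.mem_powersetCard]
      refine ⟨⟨⟨Finset.union_subset hWU ((hTF W i hi).trans (hFU i hi)), ?_⟩, hex⟩, hi,
        Finset.subset_inter (hTF W i hi) ?_, hit⟩
      · rw [Finset.card_union_of_disjoint (hTW W i hi).symm, hWw, hit]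
      · rw [hA]; exact hmin W i hi j' hj' hj'Z
    · rintro ⟨W, i⟩ h ⟨W', i'⟩ h' heq
      simp only [Finset.coe_sigma, Set.mem_sigma_iff, Finset.mem_coe, Finset.mem_filter] at h h'
      simp only [Sigma.mk.injEq, heq_eq_eq] at heq
      obtain ⟨h1, h2, h3⟩ := heq
      subst h2
      have hW : (W ∪ T W i) \ T W i = W :=
        Finset.union_sdiff_cancel_right (hTW W i h.2.1).symm
      have hW' : (W' ∪ T W' i) \ T W' i = W' :=
        Finset.union_sdiff_cancel_right (hTW W' i h'.2.1).symm
      have : W = W' := by rw [← hW, ← hW', h1, h3]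
      rw [this]
  have hcard : (Zs.card : ℝ) ≤ (U.card.choose (w + t) : ℝ) := by
    have := Finset.card_filter_le (U.powersetCard (w + t))
      fun Z => ∃ j ∈ I, F j ⊆ Z ∧ t ≤ (F j).card
    rw [Finset.card_powersetCard] at this
    exact_mod_cast this
  calc ∑ W ∈ U.powersetCard w, ((I.filter fun i => (T W i).card = t).card : ℝ)
      = (((U.powersetCard w).sigma fun W => I.filter fun i => (T W i).card = t).card : ℝ) := by
        rw [Finset.card_sigma]; push_cast; rfl
    _ ≤ ((Zs.sigma fun Z => I.sigma fun i => (F i ∩ g Z).powersetCard t).card : ℝ) := by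
        exact_mod_cast hinj
    _ = ∑ Z ∈ Zs, ∑ i ∈ I, ((F i ∩ g Z).card.choose t : ℝ) := by
        simp [Finset.card_sigma]
    _ ≤ ∑ Z ∈ Zs, B := by
        refine Finset.sum_le_sum fun Z hZ => ?_
        obtain ⟨j, hj, -, hjt, hA⟩ := hg Z (Finset.mem_filter.1 hZ).2
        rw [hA]; exact hB j hj hjt
    _ = Zs.card * B := by simp
    _ ≤ _ := mul_le_mul_of_nonneg_right hcard hB0

/-- Consecutive binomials have ratio at most `N / (w + t + 1) ≤ x`. -/
theorem choose_add_le_pow_mul_choose (N w : ℕ) (x : ℝ) (hw : 0 < w) (hx : (N : ℝ) ≤ x * w) (t : ℕ) :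
    (N.choose (w + t) : ℝ) ≤ x ^ t * (N.choose w : ℝ) := by
  have hx0 : 0 ≤ x := by
    by_contra! h
    have : x * w < 0 := mul_neg_of_neg_of_pos h (by exact_mod_cast hw)
    linarith [Nat.cast_nonneg (α := ℝ) N]
  induction t with
  | zero => simp
  | succ t ih =>
    have h := Nat.choose_succ_right_eq N (w + t)
    have h1 : (N.choose (w + t + 1) : ℝ) * (w + t + 1) ≤ N.choose (w + t) * N := by
      have : N.choose (w + t + 1) * (w + t + 1) ≤ N.choose (w + t) * N := by
        rw [h]; exact Nat.mul_le_mul_left _ (Nat.sub_le _ _)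
      exact_mod_cast this
    have hpos : (0 : ℝ) < w + t + 1 := by positivity
    have h2 : (N : ℝ) ≤ x * (w + t + 1) := hx.trans (by gcongr; linarith [Nat.cast_nonneg (α := ℝ) t])
    have h3 : (N.choose (w + t + 1) : ℝ) ≤ x * N.choose (w + t) := by
      refine le_of_mul_le_mul_right (h1.trans ?_) hpos
      calc (N.choose (w + t) : ℝ) * N ≤ N.choose (w + t) * (x * (w + t + 1)) := by gcongr
        _ = _ := by ring
    calc (N.choose (w + (t + 1)) : ℝ) ≤ x * N.choose (w + t) := h3
      _ ≤ x * (x ^ t * N.choose w) := by gcongr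
      _ = _ := by ring

/-- On average over `W`, few edges have a minimal fragment with more than `r'` elements. -/
theorem exists_fragments {V ι : Type*} [DecidableEq V] (I : Finset ι) (F : ι → Finset V)
    (U : Finset V) (w r r' : ℕ) (x : ℝ) (b : ℕ → ℝ)
    (hw : 0 < w) (hx : (U.card : ℝ) ≤ x * w)
    (hFU : ∀ i ∈ I, F i ⊆ U) (hFr : ∀ i ∈ I, (F i).card ≤ r)
    (hb0 : ∀ t, 0 ≤ b t)
    (hb : ∀ t, r' < t → ∀ j ∈ I, t ≤ (F j).card →
      ∑ i ∈ I, ((F i ∩ F j).card.choose t : ℝ) ≤ b t) :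
    ∃ T : Finset V → ι → Finset V,
      (∀ W, ∀ i ∈ I, T W i ⊆ F i) ∧ (∀ W, ∀ i ∈ I, Disjoint (T W i) W) ∧
      (∀ W, ∀ i ∈ I, ∃ j ∈ I, F j ⊆ W ∪ T W i) ∧
      ∑ W ∈ U.powersetCard w, ((I.filter fun i => r' < (T W i).card).card : ℝ) ≤
        (U.card.choose w : ℝ) * ∑ t ∈ Finset.Ioc r' r, x ^ t * b t := by
  classical
  have hex : ∀ (W : Finset V) (i : ι), ∃ T : Finset V, i ∈ I → T ⊆ F i ∧ Disjoint T W ∧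
      (∃ j ∈ I, T = F j \ W) ∧ ∀ j ∈ I, F j ⊆ W ∪ T → T ⊆ F j := by
    intro W i
    by_cases hi : i ∈ I
    · obtain ⟨T, hT⟩ := exists_minimal_fragment I F W i hi
      exact ⟨T, fun _ => hT⟩
    · exact ⟨∅, fun h => absurd h hi⟩
  choose T hT using hex
  refine ⟨T, fun W i hi => (hT W i hi).1, fun W i hi => (hT W i hi).2.1, fun W i hi => ?_, ?_⟩
  · obtain ⟨j, hj, h⟩ := (hT W i hi).2.2.1
    exact ⟨j, hj, by rw [h]; simp⟩
  have hsplit : ∀ W, ((I.filter fun i => r' < (T W i).card).card : ℝ) =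
      ∑ t ∈ Finset.Ioc r' r, ((I.filter fun i => (T W i).card = t).card : ℝ) := by
    intro W
    rw [Finset.card_eq_sum_card_fiberwise (f := fun i => (T W i).card) (t := Finset.Ioc r' r)]
    · push_cast
      refine Finset.sum_congr rfl fun t ht => ?_
      rw [Finset.filter_filter]
      congr 2
      ext i
      simp only [Finset.mem_filter]
      have := (Finset.mem_Ioc.1 ht).1
      constructor
      · rintro ⟨h1, -, h3⟩; exact ⟨h1, h3⟩
      · rintro ⟨h1, h3⟩; exact ⟨h1, h3 ▸ this, h3⟩
    · intro i hi
      simp only [Finset.coe_filter, Set.mem_ofPred_eq] at hi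
      exact Finset.mem_coe.2 (Finset.mem_Ioc.2 ⟨hi.2,
        (Finset.card_le_card (hT W i hi.1).1).trans (hFr i hi.1)⟩)
  simp only [hsplit]
  rw [Finset.sum_comm, Finset.mul_sum]
  refine Finset.sum_le_sum fun t ht => ?_
  refine (sum_card_fragment_eq_le I F U w t (b t) T hFU (fun W i hi => (hT W i hi).1)
    (fun W i hi => (hT W i hi).2.1) (fun W i hi => (hT W i hi).2.2.1)
    (fun W i hi => (hT W i hi).2.2.2) (hb0 t) (hb t (Finset.mem_Ioc.1 ht).1)).trans ?_
  calc (U.card.choose (w + t) : ℝ) * b t ≤ (x ^ t * U.card.choose w) * b t :=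
        mul_le_mul_of_nonneg_right (choose_add_le_pow_mul_choose _ w x hw hx t) (hb0 t)
    _ = _ := by ring

/-! ### Revealing the random set in stages -/

/-- Splitting a uniformly random `m`-subset of `U` into a random `w`-subset and the rest. -/
theorem choose_mul_card_filter_eq {V : Type*} [DecidableEq V] (U : Finset V) (m w : ℕ)
    (hwm : w ≤ m) (P : Finset V → Prop) [DecidablePred P] :
    m.choose w * ((U.powersetCard m).filter P).card =
      ∑ W ∈ U.powersetCard w, (((U \ W).powersetCard (m - w)).filter fun X => P (W ∪ X)).card := by
  rw [← Finset.card_sigma]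
  have : m.choose w * ((U.powersetCard m).filter P).card =
      (((U.powersetCard m).filter P).sigma fun Y => Y.powersetCard w).card := by
    rw [Finset.card_sigma, Finset.sum_congr rfl (g := fun _ => m.choose w)]
    · simp [mul_comm]
    · intro Y hY
      rw [Finset.card_powersetCard, (Finset.mem_powersetCard.1 (Finset.mem_filter.1 hY).1).2]
  rw [this]
  refine Finset.card_bij' (fun p _ => ⟨p.2, p.1 \ p.2⟩) (fun p _ => ⟨p.1 ∪ p.2, p.1⟩) ?_ ?_ ?_ ?_
  · rintro ⟨Y, W⟩ h
    simp only [Finset.mem_sigma, Finset.mem_filter, Finset.mem_powersetCard] at h ⊢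
    obtain ⟨⟨⟨h1, h2⟩, h3⟩, h4, h5⟩ := h
    refine ⟨⟨h4.trans h1, h5⟩, ⟨Finset.sdiff_subset_sdiff h1 subset_rfl, ?_⟩, ?_⟩
    · rw [Finset.card_sdiff_of_subset h4, h2, h5]
    · rwa [Finset.union_sdiff_of_subset h4]
  · rintro ⟨W, X⟩ h
    simp only [Finset.mem_sigma, Finset.mem_filter, Finset.mem_powersetCard] at h ⊢
    obtain ⟨⟨h1, h2⟩, ⟨h3, h4⟩, h5⟩ := h
    have hd : Disjoint W X := (Finset.subset_sdiff.1 h3).2.symm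
    refine ⟨⟨⟨Finset.union_subset h1 (h3.trans Finset.sdiff_subset), ?_⟩, h5⟩,
      Finset.subset_union_left, h2⟩
    rw [Finset.card_union_of_disjoint hd, h2, h4]; omega
  · rintro ⟨Y, W⟩ h
    simp only [Finset.mem_sigma, Finset.mem_powersetCard] at h
    simp [Finset.union_sdiff_of_subset h.2.1]
  · rintro ⟨W, X⟩ h
    simp only [Finset.mem_sigma, Finset.mem_filter, Finset.mem_powersetCard] at h
    have hd : Disjoint W X := (Finset.subset_sdiff.1 h.2.1.1).2.symm
    simp [Finset.union_sdiff_cancel_left hd]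

/-- Revealing `W` in stages of sizes `w a, …, w ℓ`: after stage `j` the surviving fragments have at
most `ρ (j + 1)` elements. The edges lost on the way are counted against the original family. -/
theorem card_fail_mul_card_le {V ι : Type*} [DecidableEq V] [Fintype ι] (S : ι → Finset V)
    (n ℓ : ℕ) (w ρ : ℕ → ℕ) (x : ℕ → ℝ) (b : ℕ → ℕ → ℝ)
    (hw : ∀ j, 1 ≤ j → j ≤ ℓ → 0 < w j)
    (hx : ∀ j, 1 ≤ j → j ≤ ℓ → (n : ℝ) ≤ x j * w j)
    (hb0 : ∀ j, 1 ≤ j → j ≤ ℓ → ∀ t, 0 ≤ b j t) (hρ : ρ (ℓ + 1) = 0)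
    (hb : ∀ j, 1 ≤ j → j ≤ ℓ → ∀ t, ρ (j + 1) < t → ∀ A : Finset V, (∃ i, A ⊆ S i) →
      t ≤ A.card → A.card ≤ ρ j → ∑ i, ((S i ∩ A).card.choose t : ℝ) ≤ b j t)
    (k a : ℕ) (ha : 1 ≤ a) (hak : a + k = ℓ + 1) (m : ℕ) (U : Finset V) (I : Finset ι)
    (F : ι → Finset V) (hUn : U.card ≤ n) (hmU : m ≤ U.card)
    (hFU : ∀ i ∈ I, F i ⊆ U) (hFS : ∀ i ∈ I, F i ⊆ S i) (hFρ : ∀ i ∈ I, (F i).card ≤ ρ a)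
    (hwm : ∑ j ∈ Finset.Ico a (ℓ + 1), w j ≤ m) :
    (((U.powersetCard m).filter fun W => ¬ ∃ i ∈ I, F i ⊆ W).card : ℝ) * I.card ≤
      (U.card.choose m : ℝ) * ∑ j ∈ Finset.Ico a (ℓ + 1),
        ∑ t ∈ Finset.Ioc (ρ (j + 1)) (ρ j), x j ^ t * b j t := by
  classical
  induction k generalizing a m U I F with
  | zero =>
    obtain rfl : a = ℓ + 1 := by omega
    simp only [Finset.Ico_self, Finset.sum_empty, mul_zero]
    rcases I.eq_empty_or_nonempty with rfl | ⟨i, hi⟩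
    · simp
    · have hF : F i = ∅ := by
        have := hFρ i hi
        rw [hρ] at this
        exact Finset.card_eq_zero.1 (Nat.le_zero.1 this)
      rw [Finset.filter_false_of_mem]
      · simp
      · intro W _ h
        exact h ⟨i, hi, by simp [hF]⟩
  | succ k ih =>
    have haℓ : a < ℓ + 1 := by omega
    rw [Finset.sum_eq_sum_Ico_succ_bot haℓ] at hwm ⊢
    set Δ := ∑ j ∈ Finset.Ico (a + 1) (ℓ + 1),
        ∑ t ∈ Finset.Ioc (ρ (j + 1)) (ρ j), x j ^ t * b j t
    have hwa : w a ≤ m := by omega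
    obtain ⟨T, hTF, hTW, hT, hdead⟩ := exists_fragments I F U (w a) (ρ a) (ρ (a + 1)) (x a) (b a)
      (hw a ha (by omega))
      (le_trans (by exact_mod_cast hUn) (hx a ha (by omega))) hFU hFρ (hb0 a ha (by omega)) (by
        intro t ht j hj htj
        -- Fragments lie in their original edges, so passing to the full family `S` only increases
        -- the sum.
        refine le_trans ?_ (hb a ha (by omega) t ht (F j) ⟨j, hFS j hj⟩ htj (hFρ j hj))
        refine (Finset.sum_le_sum fun i hi => ?_).trans
          (Finset.sum_le_sum_of_subset_of_nonneg (Finset.subset_univ I)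
            fun i _ _ => Nat.cast_nonneg _)
        exact_mod_cast Nat.choose_le_choose t
          (Finset.card_le_card (Finset.inter_subset_inter_right (hFS i hi))))
    set N := U.card
    set fails : Finset V → ℝ := fun W => ((((U \ W).powersetCard (m - w a)).filter
      fun X => ¬ ∃ i ∈ I, F i ⊆ W ∪ X).card : ℝ) with hfails
    set dead : Finset V → ℝ := fun W =>
      ((I.filter fun i => ρ (a + 1) < (T W i).card).card : ℝ) with hdd
    have hsplit : (m.choose (w a) : ℝ) *
        (((U.powersetCard m).filter fun W => ¬ ∃ i ∈ I, F i ⊆ W).card : ℝ) =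
        ∑ W ∈ U.powersetCard (w a), fails W := by
      simp only [hfails]
      exact_mod_cast choose_mul_card_filter_eq U m (w a) hwa fun W => ¬ ∃ i ∈ I, F i ⊆ W
    have hone : ∀ W ∈ U.powersetCard (w a), fails W * I.card ≤
        ((N - w a).choose (m - w a) : ℝ) * (Δ + dead W) := by
      intro W hW
      obtain ⟨hWU, hWw⟩ := Finset.mem_powersetCard.1 hW
      have hUW : (U \ W).card = N - w a := by rw [Finset.card_sdiff_of_subset hWU, hWw]
      have h1 := ih (a + 1) (by omega) (by omega) (m - w a) (U \ W)
        (I.filter fun i => ¬ ρ (a + 1) < (T W i).card) (T W) (by omega) (by omega)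
        (fun i hi => Finset.subset_sdiff.2 ⟨(hTF W i (Finset.mem_filter.1 hi).1).trans
          (hFU i (Finset.mem_filter.1 hi).1), hTW W i (Finset.mem_filter.1 hi).1⟩)
        (fun i hi => (hTF W i (Finset.mem_filter.1 hi).1).trans
          (hFS i (Finset.mem_filter.1 hi).1))
        (fun i hi => not_lt.1 (Finset.mem_filter.1 hi).2) (by omega)
      rw [hUW] at h1
      set I' := I.filter fun i => ¬ ρ (a + 1) < (T W i).card
      set f' : ℝ := ((((U \ W).powersetCard (m - w a)).filter
        fun X => ¬ ∃ i ∈ I', T W i ⊆ X).card : ℝ)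
      have hff : fails W ≤ f' := by
        refine Nat.cast_le.2 (Finset.card_le_card ?_)
        intro X hX
        rw [Finset.mem_filter] at hX ⊢
        refine ⟨hX.1, fun ⟨i, hi, hiX⟩ => hX.2 ?_⟩
        obtain ⟨j, hj, hjT⟩ := hT W i (Finset.mem_filter.1 hi).1
        exact ⟨j, hj, hjT.trans (Finset.union_subset_union_right hiX)⟩
      have hI : (I.card : ℝ) = dead W + I'.card := by
        simp only [hdd]
        exact_mod_cast (Finset.card_filter_add_card_filter_not _).symm
      have hf' : f' ≤ ((N - w a).choose (m - w a) : ℝ) := by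
        rw [← hUW, ← Finset.card_powersetCard]
        exact Nat.cast_le.2 (Finset.card_filter_le _ _)
      have hd0 : 0 ≤ dead W := Nat.cast_nonneg _
      -- Surviving edges are handled by induction; each discarded edge is charged the trivial bound,
      -- the number of all completions.
      calc fails W * I.card ≤ f' * I.card := by gcongr
        _ = f' * I'.card + f' * dead W := by rw [hI]; ring
        _ ≤ ((N - w a).choose (m - w a) : ℝ) * Δ + ((N - w a).choose (m - w a) : ℝ) * dead W :=
          add_le_add h1 (mul_le_mul_of_nonneg_right hf' hd0)
        _ = _ := by ring
    have hpos : (0 : ℝ) < m.choose (w a) := by exact_mod_cast Nat.choose_pos hwa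
    have hid : (N.choose m : ℝ) * m.choose (w a) =
        N.choose (w a) * (N - w a).choose (m - w a) := by
      exact_mod_cast Nat.choose_mul (n := N) hwa
    refine le_of_mul_le_mul_left ?_ hpos
    calc (m.choose (w a) : ℝ) *
          ((((U.powersetCard m).filter fun W => ¬ ∃ i ∈ I, F i ⊆ W).card : ℝ) * I.card)
        = ∑ W ∈ U.powersetCard (w a), fails W * I.card := by
          rw [← mul_assoc, hsplit, Finset.sum_mul]
      _ ≤ ∑ W ∈ U.powersetCard (w a), ((N - w a).choose (m - w a) : ℝ) * (Δ + dead W) :=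
          Finset.sum_le_sum hone
      _ = ((N - w a).choose (m - w a) : ℝ) *
          (N.choose (w a) * Δ + ∑ W ∈ U.powersetCard (w a), dead W) := by
          rw [← Finset.mul_sum, Finset.sum_add_distrib, Finset.sum_const, nsmul_eq_mul,
            Finset.card_powersetCard]
      _ ≤ ((N - w a).choose (m - w a) : ℝ) * (N.choose (w a) * Δ + N.choose (w a) *
          ∑ t ∈ Finset.Ioc (ρ (a + 1)) (ρ a), x a ^ t * b a t) := by gcongr
      _ = (N.choose (w a) * (N - w a).choose (m - w a) : ℝ) *
          (∑ t ∈ Finset.Ioc (ρ (a + 1)) (ρ a), x a ^ t * b a t + Δ) := by ring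
      _ = _ := by rw [← hid]; ring

/-! ### Binomial sums from spreadness and from degrees -/

/-- With `c = |A ∩ S i| ≥ t`, the binomial is at most `2 ^ c`, the term `j = c` of a sum of `2 ^ j`
over `t ≤ j ≤ c`. Exchanging sums leaves tail counts and a geometric series of ratio `2q ≤ 1/2`. -/
theorem sum_choose_card_inter_le_of_tail {V ι : Type*} [DecidableEq V] [Fintype ι]
    (S : ι → Finset V) (A : Finset V) (t : ℕ) (q D : ℝ) (hq : 0 ≤ q) (hq4 : 2 * q ≤ 1 / 2)
    (hD : 0 ≤ D)
    (h : ∀ j, t ≤ j → ((Finset.univ.filter fun i => j ≤ (A ∩ S i).card).card : ℝ) ≤ q ^ j * D) :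
    ∑ i, ((S i ∩ A).card.choose t : ℝ) ≤ 2 * (2 * q) ^ t * D := by
  have hpt : ∀ i, ((S i ∩ A).card.choose t : ℝ) ≤
      ∑ j ∈ Finset.Ico t (A.card + 1), if j ≤ (A ∩ S i).card then (2 : ℝ) ^ j else 0 := by
    intro i
    rw [Finset.inter_comm]
    set c := (A ∩ S i).card with hc
    rcases lt_or_ge c t with hct | hct
    · rw [Nat.choose_eq_zero_of_lt hct, Nat.cast_zero]
      exact Finset.sum_nonneg fun j _ => by split_ifs <;> positivity
    · have hcA : c ≤ A.card := Finset.card_le_card Finset.inter_subset_left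
      have h1 : (c.choose t : ℝ) ≤ 2 ^ c := by exact_mod_cast Nat.choose_le_two_pow c t
      refine h1.trans (le_trans (by simp) (Finset.single_le_sum
        (f := fun j => if j ≤ c then (2 : ℝ) ^ j else 0)
        (fun j _ => ?_) (Finset.mem_Ico.2 ⟨hct, Nat.lt_succ_of_le hcA⟩)))
      split_ifs <;> positivity
  calc ∑ i, ((S i ∩ A).card.choose t : ℝ)
      ≤ ∑ i, ∑ j ∈ Finset.Ico t (A.card + 1),
          if j ≤ (A ∩ S i).card then (2 : ℝ) ^ j else 0 := Finset.sum_le_sum fun i _ => hpt i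
    _ = ∑ j ∈ Finset.Ico t (A.card + 1),
          2 ^ j * ((Finset.univ.filter fun i => j ≤ (A ∩ S i).card).card : ℝ) := by
        rw [Finset.sum_comm]
        refine Finset.sum_congr rfl fun j _ => ?_
        rw [← Finset.sum_filter, Finset.sum_const, nsmul_eq_mul, mul_comm]
    _ ≤ ∑ j ∈ Finset.Ico t (A.card + 1), (2 * q) ^ j * D := by
        refine Finset.sum_le_sum fun j hj => ?_
        rw [mul_pow, mul_assoc]
        gcongr
        exact h j (Finset.mem_Ico.1 hj).1
    _ = (∑ j ∈ Finset.Ico t (A.card + 1), (2 * q) ^ j) * D := by rw [Finset.sum_mul]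
    _ ≤ ((2 * q) ^ t / (1 - 2 * q)) * D := by
        gcongr
        exact geom_sum_Ico_le_of_lt_one (by positivity) (by linarith)
    _ ≤ _ := by
        gcongr
        rw [div_le_iff₀ (by linarith)]
        nlinarith [pow_nonneg (mul_nonneg zero_le_two hq) t]

/-- Double counting of pairs `(i, B)` with `B` a `t`-subset of `S i ∩ A`. -/
theorem sum_choose_card_inter_le_of_degree {V ι : Type*} [DecidableEq V] [Fintype ι]
    (S : ι → Finset V) (A : Finset V) (t k : ℕ) (q D : ℝ) (hA : A.card ≤ k) (hqD : 0 ≤ q ^ t * D)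
    (h : ∀ B, B.card = t → ((Finset.univ.filter fun i => B ⊆ S i).card : ℝ) ≤ q ^ t * D) :
    ∑ i, ((S i ∩ A).card.choose t : ℝ) ≤ (k.choose t : ℝ) * (q ^ t * D) := by
  have hpt : ∀ i, ((S i ∩ A).card.choose t : ℝ) =
      ∑ B ∈ A.powersetCard t, if B ⊆ S i then (1 : ℝ) else 0 := by
    intro i
    rw [← Finset.sum_filter, Finset.sum_const, nsmul_eq_mul, mul_one, ← Finset.card_powersetCard]
    congr 2
    ext B
    simp only [Finset.mem_powersetCard, Finset.mem_filter, Finset.subset_inter_iff]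
    tauto
  simp only [hpt]
  rw [Finset.sum_comm]
  calc ∑ B ∈ A.powersetCard t, ∑ i, (if B ⊆ S i then (1 : ℝ) else 0)
      ≤ ∑ B ∈ A.powersetCard t, q ^ t * D := by
        refine Finset.sum_le_sum fun B hB => ?_
        rw [← Finset.sum_filter, Finset.sum_const, nsmul_eq_mul, mul_one]
        exact h B (Finset.mem_powersetCard.1 hB).2
    _ = (A.card.choose t : ℝ) * (q ^ t * D) := by
        rw [Finset.sum_const, nsmul_eq_mul, Finset.card_powersetCard]
    _ ≤ _ := by
        gcongr

theorem sum_Ioc_pow_mul_le (r r' : ℕ) (x q D : ℝ) (hx : 0 ≤ x) (hq : 0 ≤ q) (hD : 0 ≤ D)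
    (hxq : 2 * x * q ≤ 1 / 2) :
    ∑ t ∈ Finset.Ioc r' r, x ^ t * (2 * (2 * q) ^ t * D) ≤ 4 * (2 * x * q) ^ (r' + 1) * D := by
  have h1 : ∑ t ∈ Finset.Ioc r' r, x ^ t * (2 * (2 * q) ^ t * D) =
      2 * (∑ t ∈ Finset.Ico (r' + 1) (r + 1), (2 * x * q) ^ t) * D := by
    rw [Finset.mul_sum, Finset.sum_mul]
    refine Finset.sum_congr ?_ fun t _ => ?_
    · ext t; simp only [Finset.mem_Ioc, Finset.mem_Ico]; omega
    · rw [show 2 * x * q = x * (2 * q) by ring, mul_pow x]; ring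
  have h2 := geom_sum_Ico_le_of_lt_one (m := r' + 1) (n := r + 1)
    (show 0 ≤ 2 * x * q by positivity) (by linarith)
  have h3 : (2 * x * q) ^ (r' + 1) / (1 - 2 * x * q) ≤ 2 * (2 * x * q) ^ (r' + 1) := by
    rw [div_le_iff₀ (by linarith)]
    nlinarith [pow_nonneg (show 0 ≤ 2 * x * q by positivity) (r' + 1)]
  rw [h1]
  calc _ ≤ 2 * (2 * (2 * x * q) ^ (r' + 1)) * D := by gcongr; exact h2.trans h3
    _ = _ := by ring

/-- The sum is `((1 + xq)^k - 1) D`, and `exp u - 1 ≤ 2u` for `0 ≤ u ≤ 1`. -/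
theorem sum_Ioc_choose_mul_le (k : ℕ) (x q D : ℝ) (hxq0 : 0 ≤ x * q) (hD : 0 ≤ D)
    (hxq : k * (x * q) ≤ 1) :
    ∑ t ∈ Finset.Ioc 0 k, x ^ t * ((k.choose t : ℝ) * (q ^ t * D)) ≤ 2 * k * (x * q) * D := by
  have h1 : ∑ t ∈ Finset.Ioc 0 k, x ^ t * ((k.choose t : ℝ) * (q ^ t * D)) =
      ((x * q + 1) ^ k - 1) * D := by
    rw [add_pow, Finset.range_eq_Ico, Finset.sum_eq_sum_Ico_succ_bot (by omega)]
    simp only [pow_zero, one_pow, mul_one, Nat.choose_zero_right, Nat.cast_one, add_sub_cancel_left]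
    rw [Finset.sum_mul]
    refine Finset.sum_congr ?_ fun t _ => ?_
    · ext t; simp only [Finset.mem_Ioc, Finset.mem_Ico]; omega
    · rw [mul_pow]; ring
  rw [h1]
  gcongr
  have h2 : (x * q + 1) ^ k ≤ Real.exp (k * (x * q)) := by
    rw [Real.exp_nat_mul]
    exact pow_le_pow_left₀ (by linarith) (Real.add_one_le_exp _) k
  have hk0 : 0 ≤ k * (x * q) := by positivity
  have h3 := Real.abs_exp_sub_one_le (x := k * (x * q)) (by rwa [abs_of_nonneg hk0])
  rw [abs_of_nonneg hk0] at h3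
  linarith [le_abs_self (Real.exp (k * (x * q)) - 1)]

/-! ### Indexed edges, degrees and the passage to probability -/

theorem exists_index {V : Type*} (H : MultiHypergraph V) :
    ∃ (ι : Type) (_ : Fintype ι) (S : ι → Finset V), H = Finset.univ.val.map S := by
  refine ⟨Fin H.toList.length, inferInstance, H.toList.get, ?_⟩
  rw [Fin.univ_val_map, List.ofFn_get, Multiset.coe_toList]

theorem card_filter_map {V ι : Type*} [Fintype ι] (S : ι → Finset V) (p : Finset V → Prop)
    [DecidablePred p] :
    Multiset.card (Multiset.filter p (Finset.univ.val.map S)) =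
      (Finset.univ.filter fun i => p (S i)).card := by
  rw [Multiset.filter_map, Multiset.card_map]
  rfl

theorem exists_le_and_succ_le (r : ℕ → ℕ) (s ℓ : ℕ) (h1 : s ≤ r 1) (hℓ : 1 ≤ ℓ)
    (h : r (ℓ + 1) ≤ s) : ∃ i, 1 ≤ i ∧ i ≤ ℓ ∧ s ≤ r i ∧ r (i + 1) ≤ s := by
  induction ℓ, hℓ using Nat.le_induction with
  | base => exact ⟨1, le_rfl, le_rfl, h1, h⟩
  | succ ℓ hℓ ih =>
    rcases le_total s (r (ℓ + 1)) with hs | hs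
    · exact ⟨ℓ + 1, by omega, le_rfl, hs, h⟩
    · obtain ⟨i, hi, hiℓ, hi'⟩ := ih hs
      exact ⟨i, hi, by omega, hi'⟩

/-- An edge containing `B` meets `B` in `|B|` vertices, so spreadness applies with `A = B` and `j =
|B|`, at the level `i` whose size range contains `|B|`. -/
theorem IsSpread.degree_le {V : Type*} [DecidableEq V] {H : MultiHypergraph V} {ℓ : ℕ}
    {q : ℕ → ℝ} {r : ℕ → ℕ} (h : H.IsSpread ℓ q r) (hℓ : 1 ≤ ℓ) (hr : r (ℓ + 1) = 1) {M : ℝ}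
    (hM : ∀ i, 1 ≤ i → i ≤ ℓ → q i ≤ M) (B : Finset V) (hB : 0 < B.card) :
    (H.degree B : ℝ) ≤ M ^ B.card * Multiset.card H := by
  have hM0 : 0 ≤ M := (h.q_pos 1 le_rfl hℓ).le.trans (hM 1 le_rfl hℓ)
  rcases Nat.eq_zero_or_pos (H.degree B) with h0 | h0
  · rw [h0, Nat.cast_zero]; positivity
  obtain ⟨S, hS⟩ := Multiset.card_pos_iff_exists_mem.1 h0
  rw [Multiset.mem_filter] at hS
  obtain ⟨i, hi, hiℓ, hBi, hiB⟩ := exists_le_and_succ_le r B.card ℓ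
    ((Finset.card_le_card hS.2).trans (h.bounded S hS.1)) hℓ (by omega)
  have h1 : H.degree B ≤ H.meetCount B.card B := by
    refine Multiset.card_le_card (Multiset.monotone_filter_right _ fun S hBS => ?_)
    rw [Finset.inter_eq_left.2 hBS]
  calc (H.degree B : ℝ) ≤ H.meetCount B.card B := by exact_mod_cast h1
    _ ≤ q i ^ B.card * Multiset.card H := h.spread i hi hiℓ B h0 hBi hiB _ hiB
    _ ≤ _ := by
      have := (h.q_pos i hi hiℓ).le
      gcongr
      exact hM i hi hiℓ

/-- Since `exp 2 ≤ 8`. The square in the denominator lets the losses of up to `ℓ` early stages be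
summed. -/
theorem one_eighth_pow_le (ℓ k : ℕ) (hk : Real.log ((ℓ : ℝ) + 1) ≤ k) :
    (1 / 8 : ℝ) ^ k ≤ 1 / ((ℓ : ℝ) + 1) ^ 2 := by
  have hpos : (0 : ℝ) < (ℓ : ℝ) + 1 := by positivity
  have h8 : Real.exp 2 ≤ 8 := by
    have h1 := Real.exp_one_lt_d9
    have h2 : Real.exp 2 = Real.exp 1 ^ 2 := by rw [← Real.exp_nat_mul]; norm_num
    rw [h2]
    nlinarith [Real.exp_pos 1]
  have h1 : ((ℓ : ℝ) + 1) ^ 2 ≤ 8 ^ k := by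
    calc ((ℓ : ℝ) + 1) ^ 2 = Real.exp (2 * Real.log ((ℓ : ℝ) + 1)) := by
          rw [← Real.exp_log hpos, ← Real.exp_nat_mul, Real.log_exp]; norm_num
      _ ≤ Real.exp (k * 2) := Real.exp_le_exp.2 (by linarith)
      _ = Real.exp 2 ^ k := by rw [Real.exp_nat_mul]
      _ ≤ 8 ^ k := by gcongr
  rw [one_div_pow]
  exact one_div_le_one_div_of_le (by positivity) h1

theorem one_sub_le_probContainsEdge {V ι : Type*} [Fintype V] [DecidableEq V] [Fintype ι]
    [Nonempty ι] (S : ι → Finset V) (m : ℕ) (ε : ℝ) (hm : m ≤ Fintype.card V)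
    (h : (((Finset.univ.powersetCard m).filter
        fun W => ¬ ∃ i ∈ (Finset.univ : Finset ι), S i ⊆ W).card : ℝ) * Fintype.card ι ≤
      ((Fintype.card V).choose m : ℝ) * (ε * Fintype.card ι)) :
    1 - ε ≤ probContainsEdge (Finset.univ.val.map S) m := by
  classical
  have hD : (0 : ℝ) < Fintype.card ι := by exact_mod_cast Fintype.card_pos
  have hN : (0 : ℝ) < (Fintype.card V).choose m := by exact_mod_cast Nat.choose_pos hm
  have hcompl := Finset.card_filter_add_card_filter_not
    (s := (Finset.univ : Finset V).powersetCard m)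
    (fun W => ∃ i ∈ (Finset.univ : Finset ι), S i ⊆ W)
  rw [Finset.card_powersetCard, Finset.card_univ] at hcompl
  have h2 : ((((Finset.univ : Finset V).powersetCard m).filter
      fun W => ∃ i ∈ (Finset.univ : Finset ι), S i ⊆ W).card : ℝ) +
      (((Finset.univ.powersetCard m).filter
        fun W => ¬ ∃ i ∈ (Finset.univ : Finset ι), S i ⊆ W).card : ℝ) =
      ((Fintype.card V).choose m : ℝ) := by exact_mod_cast hcompl
  have h3 := le_of_mul_le_mul_right (h.trans_eq (mul_assoc _ _ _).symm) hD
  have h4 : ((Finset.univ : Finset V).powersetCard m).filter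
      (fun W => ∃ A ∈ Finset.univ.val.map S, A ⊆ W) =
      ((Finset.univ : Finset V).powersetCard m).filter
      (fun W => ∃ i ∈ (Finset.univ : Finset ι), S i ⊆ W) := by
    ext W; simp
  unfold probContainsEdge
  rw [Finset.card_powersetCard, Finset.card_univ, le_div_iff₀ hN]
  have h5 : ((((Finset.univ : Finset V).powersetCard m).filter
      (fun W => ∃ A ∈ Finset.univ.val.map S, A ⊆ W)).card : ℝ) =
      ((((Finset.univ : Finset V).powersetCard m).filter
      fun W => ∃ i ∈ (Finset.univ : Finset ι), S i ⊆ W).card : ℝ) := by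
    rw [h4]
  have h6 : (1 - ε) * ((Fintype.card V).choose m : ℝ) ≤
      ((((Finset.univ : Finset V).powersetCard m).filter
      (fun W => ∃ A ∈ Finset.univ.val.map S, A ⊆ W)).card : ℝ) := by
    rw [h5]; linarith
  convert h6

/-! ### Choice of the stages and the total loss -/

/-- The bound for a spread family, with `M` an upper bound for the `q i` and `m` the size of the
random set. -/
theorem IsSpread.one_sub_le_probContainsEdge {V : Type*} [Fintype V] [DecidableEq V]
    {H : MultiHypergraph V} {ℓ : ℕ} {q : ℕ → ℝ} {r : ℕ → ℕ} (h : H.IsSpread ℓ q r) (hℓ : 1 ≤ ℓ)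
    (hr : r (ℓ + 1) = 1) {C Q M : ℝ} (hQ : ∑ i ∈ Finset.Icc 1 ℓ, q i = Q)
    (hM : ∀ i, 1 ≤ i → i ≤ ℓ → q i ≤ M) (hC : 128 ≤ C) (hCQ : C * Q ≤ 1)
    (hn : ∀ i, 1 ≤ i → i ≤ ℓ → 2 ≤ C * q i * Fintype.card V)
    (hε : 128 * Real.log ((ℓ : ℝ) + 1) * (M / (C * Q)) ≤ 1) :
    1 - 128 * Real.log ((ℓ : ℝ) + 1) * (M / (C * Q)) ≤
      H.probContainsEdge ⌈C * Q * (Fintype.card V : ℝ)⌉₊ := by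
  classical
  obtain ⟨ι, _, S, hHS⟩ := exists_index H
  have hHD : Multiset.card H = Fintype.card ι := by rw [hHS, Multiset.card_map]; rfl
  have : Nonempty ι := by
    rw [← Fintype.card_pos_iff, ← hHD]
    exact Multiset.card_pos.2 h.nonempty
  set D : ℝ := (Fintype.card ι : ℝ) with hD
  have hD0 : 0 ≤ D := Nat.cast_nonneg _
  set n := Fintype.card V with hn_def
  set lam := Real.log ((ℓ : ℝ) + 1) with hlam
  set g := M / (C * Q) with hg
  have hC0 : 0 < C := by linarith
  have hq0 : ∀ i, 1 ≤ i → i ≤ ℓ → 0 < q i := h.q_pos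
  have hqQ : ∀ i, 1 ≤ i → i ≤ ℓ → q i ≤ Q := by
    intro i hi hiℓ
    rw [← hQ]
    exact Finset.single_le_sum (f := q)
      (fun j hj => (hq0 j (Finset.mem_Icc.1 hj).1 (Finset.mem_Icc.1 hj).2).le)
      (Finset.mem_Icc.2 ⟨hi, hiℓ⟩)
  have hQ0 : 0 < Q := (hq0 1 le_rfl hℓ).trans_le (hqQ 1 le_rfl hℓ)
  have hM0 : 0 < M := (hq0 1 le_rfl hℓ).trans_le (hM 1 le_rfl hℓ)
  have hCQ0 : 0 < C * Q := by positivity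
  have hg0 : 0 < g := by positivity
  have hq4 : ∀ i, 1 ≤ i → i ≤ ℓ → 2 * q i ≤ 1 / 2 := by
    intro i hi hiℓ
    have := hqQ i hi hiℓ
    nlinarith
  have hℓ1 : (1 : ℝ) ≤ ℓ := by exact_mod_cast hℓ
  have hlam2 : 1 / 2 ≤ lam := by
    have h1 := Real.log_two_gt_d9
    have h2 : Real.log 2 ≤ lam := Real.log_le_log (by norm_num) (by linarith)
    linarith
  set k := ⌈lam⌉₊ with hk
  have hk1 : lam ≤ k := Nat.le_ceil _
  have hk2 : (k : ℝ) ≤ 3 * lam := by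
    have := Nat.ceil_lt_add_one (show 0 ≤ lam by linarith)
    linarith
  have hQℓ : Q ≤ ℓ * M := by
    rw [← hQ]
    refine (Finset.sum_le_card_nsmul _ _ M fun i hi =>
      hM i (Finset.mem_Icc.1 hi).1 (Finset.mem_Icc.1 hi).2).trans ?_
    simp
  -- The early losses add up to order `1 / (C ℓ)`; this absorbs them into `g = 1 / (C L)` when `M`
  -- is the maximum.
  have hgℓ : 1 / (C * ℓ) ≤ g := by
    rw [hg, div_le_div_iff₀ (by positivity) hCQ0]
    nlinarith
  have hlg : g ≤ 2 * (lam * g) := by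
    have := mul_le_mul_of_nonneg_right hlam2 hg0.le
    linarith
  have hkg : k * g ≤ 3 * (lam * g) := by
    have := mul_le_mul_of_nonneg_right hk2 hg0.le
    linarith
  -- The last stage is given weight `Q` in place of `q ℓ`, which turns its loss from order `1 / C`
  -- into order `M / (C Q)`. The weights then sum to at most `2Q`, whence the factor `1/2` in `w`.
  set y : ℕ → ℝ := fun j => if j = ℓ then Q else q j with hy
  have hqy : ∀ j, 1 ≤ j → j ≤ ℓ → q j ≤ y j := by
    intro j hj hjℓ
    simp only [hy]
    split_ifs with h'
    · exact hqQ j hj hjℓ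
    · exact le_rfl
  have hy0 : ∀ j, 1 ≤ j → j ≤ ℓ → 0 < y j := fun j hj hjℓ =>
    (hq0 j hj hjℓ).trans_le (hqy j hj hjℓ)
  set w : ℕ → ℕ := fun j => ⌊C * y j * n / 2⌋₊ with hwdef
  have hwge : ∀ j, 1 ≤ j → j ≤ ℓ → 1 ≤ C * y j * n / 2 := by
    intro j hj hjℓ
    have h1 := hn j hj hjℓ
    have h2 : C * q j * n ≤ C * y j * n := by
      gcongr
      exact hqy j hj hjℓ
    linarith
  -- Rounding down a number that is at least 1 loses at most a factor 2, so `w j ≥ C * y j * n / 4`.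
  set x : ℕ → ℝ := fun j => 4 / (C * y j) with hx
  -- The value 0 beyond `ℓ` demands that only empty fragments survive the last stage.
  set ρ : ℕ → ℕ := fun j => if j ≤ ℓ then max (r j) k else 0 with hρ
  set b : ℕ → ℕ → ℝ := fun j t => if j < ℓ ∨ k ≤ r ℓ then 2 * (2 * q j) ^ t * D
    else (k.choose t : ℝ) * (M ^ t * D) with hb
  have hspread : ∀ j, 1 ≤ j → j ≤ ℓ → ∀ A : Finset V, (∃ i, A ⊆ S i) → A.card ≤ r j →
      ∀ t, r (j + 1) ≤ t → t ≤ A.card →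
      ∑ i, ((S i ∩ A).card.choose t : ℝ) ≤ 2 * (2 * q j) ^ t * D := by
    intro j hj hjℓ A ⟨i, hi⟩ hA t ht htA
    refine sum_choose_card_inter_le_of_tail S A t (q j) D (hq0 j hj hjℓ).le (hq4 j hj hjℓ) hD0 ?_
    intro s hs
    have h0 : 0 < H.degree A := by
      refine Multiset.card_pos_iff_exists_mem.2 ⟨S i, Multiset.mem_filter.2 ⟨?_, hi⟩⟩
      rw [hHS]
      exact Multiset.mem_map_of_mem S (Finset.mem_univ i)
    have h1 := h.spread j hj hjℓ A h0 hA (ht.trans htA) s (ht.trans hs)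
    rw [hHD] at h1
    unfold meetCount at h1
    rwa [hHS, card_filter_map] at h1
  have hdeg : ∀ t, 0 < t → ∀ A : Finset V, A.card ≤ k →
      ∑ i, ((S i ∩ A).card.choose t : ℝ) ≤ (k.choose t : ℝ) * (M ^ t * D) := by
    intro t ht A hA
    refine sum_choose_card_inter_le_of_degree S A t k M D hA (by positivity) ?_
    rintro B rfl
    have h1 := h.degree_le hℓ hr hM B ht
    rw [hHD] at h1
    unfold degree at h1
    rwa [hHS, card_filter_map] at h1
  have key := card_fail_mul_card_le S n ℓ w ρ x b
    (fun j hj hjℓ => Nat.floor_pos.2 (hwge j hj hjℓ))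
    (fun j hj hjℓ => by
      have h1 := hwge j hj hjℓ
      have h2 := Nat.lt_floor_add_one (C * y j * n / 2)
      have h3 : (1 : ℝ) ≤ (w j : ℝ) := by exact_mod_cast Nat.floor_pos.2 h1
      have h4 : C * y j * n / 4 ≤ w j := by
        simp only [hwdef] at h3 ⊢
        linarith
      have hyj := hy0 j hj hjℓ
      calc (n : ℝ) = x j * (C * y j * n / 4) := by simp only [hx]; field_simp
        _ ≤ _ := by gcongr)
    (fun j hj hjℓ t => by
      have := hq0 j hj hjℓ
      simp only [hb]; split_ifs <;> positivity)
    (by simp [hρ])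
    (fun j hj hjℓ t ht A hAS htA hAρ => by
      simp only [hρ, hjℓ, if_true] at hAρ
      simp only [hb]
      rcases Nat.lt_or_ge j ℓ with hjl | hjl
      · rw [if_pos (Or.inl hjl)]
        simp only [hρ, Nat.succ_le_of_lt hjl, if_true] at ht
        rw [max_lt_iff] at ht
        refine hspread j hj hjℓ A hAS ?_ t ht.1.le htA
        rcases le_max_iff.1 hAρ with h' | h'
        · exact h'
        -- Here `|A| ≤ k < t ≤ |A|`, so the raised threshold adds no new case.
        · omega
      · obtain rfl : j = ℓ := le_antisymm hjℓ hjl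
        by_cases hkr : k ≤ r j
        · rw [if_pos (Or.inr hkr)]
          rw [max_eq_left hkr] at hAρ
          exact hspread j hj hjℓ A hAS hAρ t (by omega) htA
        · rw [if_neg (by omega)]
          rw [max_eq_right (by omega)] at hAρ
          exact hdeg t (by omega) A hAρ)
    ℓ 1 le_rfl (by omega) ⌈C * Q * (n : ℝ)⌉₊ Finset.univ Finset.univ S
    (by rw [Finset.card_univ])
    (by
      rw [Finset.card_univ, Nat.ceil_le]
      exact (mul_le_mul_of_nonneg_right hCQ (Nat.cast_nonneg n)).trans_eq (one_mul _))
    (fun i _ => Finset.subset_univ _) (fun i _ => subset_rfl)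
    (fun i _ => by
      simp only [hρ, hℓ, if_true]
      refine le_max_of_le_left (h.bounded _ ?_)
      rw [hHS]
      exact Multiset.mem_map_of_mem S (Finset.mem_univ i))
    (by
      have h1 : ((∑ j ∈ Finset.Ico 1 (ℓ + 1), w j : ℕ) : ℝ) ≤ C * Q * n := by
        push_cast
        calc ∑ j ∈ Finset.Ico 1 (ℓ + 1), (w j : ℝ)
            ≤ ∑ j ∈ Finset.Ico 1 (ℓ + 1), C * y j * n / 2 := by
              refine Finset.sum_le_sum fun j hj => Nat.floor_le ?_
              rw [Finset.mem_Ico] at hj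
              linarith [hwge j hj.1 (by omega)]
          _ = (C * n / 2) * (∑ j ∈ Finset.Ico 1 ℓ, q j + Q) := by
              rw [Finset.sum_Ico_succ_top hℓ, mul_add, Finset.mul_sum]
              congr 1
              · refine Finset.sum_congr rfl fun j hj => ?_
                rw [Finset.mem_Ico] at hj
                simp only [hy, if_neg hj.2.ne]
                ring
              · simp only [hy, if_true]
                ring
          _ ≤ (C * n / 2) * (Q + Q) := by
              gcongr
              rw [← hQ]
              refine Finset.sum_le_sum_of_subset_of_nonneg ?_ fun j hj _ =>
                (hq0 j (Finset.mem_Icc.1 hj).1 (Finset.mem_Icc.1 hj).2).le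
              intro j hj
              rw [Finset.mem_Ico] at hj
              exact Finset.mem_Icc.2 ⟨hj.1, hj.2.le⟩
          _ = C * Q * n := by ring
      exact_mod_cast h1.trans (Nat.le_ceil _))
  rw [Finset.card_univ, Finset.card_univ] at key
  rw [hHS]
  refine MultiHypergraph.one_sub_le_probContainsEdge S _ _ ?_ (key.trans ?_)
  · rw [Nat.ceil_le]
    exact (mul_le_mul_of_nonneg_right hCQ (Nat.cast_nonneg n)).trans_eq (one_mul _)
  refine mul_le_mul_of_nonneg_left ?_ (Nat.cast_nonneg _)
  rw [Finset.sum_Ico_succ_top hℓ]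
  have hearly : ∀ j ∈ Finset.Ico 1 ℓ, ∑ t ∈ Finset.Ioc (ρ (j + 1)) (ρ j), x j ^ t * b j t ≤
      32 / C * (1 / ((ℓ : ℝ) + 1) ^ 2) * D := by
    intro j hj
    obtain ⟨hj1, hjl⟩ := Finset.mem_Ico.1 hj
    have hqj := hq0 j hj1 hjl.le
    have hxj : x j = 4 / (C * q j) := by simp only [hx, hy, if_neg hjl.ne]
    have hxq : 2 * x j * q j = 8 / C := by rw [hxj]; field_simp; norm_num
    have h8 : 8 / C ≤ 1 / 8 := by rw [div_le_div_iff₀ hC0 (by norm_num)]; linarith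
    have hkρ : k ≤ ρ (j + 1) := by
      simp only [hρ, Nat.succ_le_of_lt hjl, if_true]
      exact le_max_right _ _
    simp only [hb, if_pos (show j < ℓ ∨ k ≤ r ℓ from Or.inl hjl)]
    refine (sum_Ioc_pow_mul_le _ _ (x j) (q j) D (by rw [hxj]; positivity) hqj.le hD0
      (by rw [hxq]; linarith)).trans ?_
    rw [hxq]
    have h80 : 0 ≤ 8 / C := by positivity
    refine mul_le_mul_of_nonneg_right ?_ hD0
    -- One factor `8 / C` is kept for the dependence on `C`; the other `k` factors, each at most
    -- `1/8`, yield `1 / (ℓ+1)²`.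
    calc 4 * (8 / C) ^ (ρ (j + 1) + 1) ≤ 4 * (8 / C) ^ (k + 1) := by
          refine mul_le_mul_of_nonneg_left (pow_le_pow_of_le_one h80 (by linarith) (by omega))
            (by norm_num)
      _ = 32 / C * (8 / C) ^ k := by ring
      _ ≤ 32 / C * (1 / 8) ^ k := by gcongr
      _ ≤ _ := by
          gcongr
          exact one_eighth_pow_le ℓ k hk1
  have hE : ∑ j ∈ Finset.Ico 1 ℓ, ∑ t ∈ Finset.Ioc (ρ (j + 1)) (ρ j), x j ^ t * b j t ≤
      64 * lam * g * D := by
    refine (Finset.sum_le_card_nsmul _ _ _ hearly).trans ?_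
    rw [nsmul_eq_mul, Nat.card_Ico]
    have h1 : ((ℓ - 1 : ℕ) : ℝ) ≤ ℓ := by exact_mod_cast Nat.sub_le _ _
    have h2 : (ℓ : ℝ) * (32 / C * (1 / ((ℓ : ℝ) + 1) ^ 2)) ≤ 32 * (1 / (C * ℓ)) := by
      have : (ℓ : ℝ) * (1 / ((ℓ : ℝ) + 1) ^ 2) ≤ 1 / ℓ := by
        rw [mul_one_div, div_le_div_iff₀ (by positivity) (by positivity)]
        nlinarith
      calc (ℓ : ℝ) * (32 / C * (1 / ((ℓ : ℝ) + 1) ^ 2))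
          = 32 / C * (ℓ * (1 / ((ℓ : ℝ) + 1) ^ 2)) := by ring
        _ ≤ 32 / C * (1 / ℓ) := by gcongr
        _ = _ := by field_simp
    calc ((ℓ - 1 : ℕ) : ℝ) * (32 / C * (1 / ((ℓ : ℝ) + 1) ^ 2) * D)
        ≤ ℓ * (32 / C * (1 / ((ℓ : ℝ) + 1) ^ 2) * D) := by gcongr
      _ = (ℓ * (32 / C * (1 / ((ℓ : ℝ) + 1) ^ 2))) * D := by ring
      _ ≤ 64 * lam * g * D := by
        refine mul_le_mul_of_nonneg_right (h2.trans ?_) hD0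
        linarith
  have hlast : ∑ t ∈ Finset.Ioc (ρ (ℓ + 1)) (ρ ℓ), x ℓ ^ t * b ℓ t ≤ 64 * lam * g * D := by
    have hxℓ : x ℓ = 4 / (C * Q) := by simp only [hx, hy, if_true]
    have hx0 : 0 ≤ x ℓ := by rw [hxℓ]; positivity
    have hxM : x ℓ * M = 4 * g := by rw [hxℓ, hg]; ring
    have hxq : x ℓ * q ℓ ≤ 4 * g := by
      rw [← hxM]
      gcongr
      exact hM ℓ hℓ le_rfl
    have hρ0 : ρ (ℓ + 1) = 0 := by simp [hρ]
    have hρℓ : ρ ℓ = max (r ℓ) k := by simp [hρ]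
    have hqℓ := hq0 ℓ hℓ le_rfl
    rw [hρ0, hρℓ]
    by_cases hkr : k ≤ r ℓ
    · simp only [hb, if_pos (show ℓ < ℓ ∨ k ≤ r ℓ from Or.inr hkr)]
      refine (sum_Ioc_pow_mul_le _ _ (x ℓ) (q ℓ) D hx0 hqℓ.le hD0 ?_).trans ?_
      · linarith
      · rw [zero_add, pow_one]
        refine mul_le_mul_of_nonneg_right ?_ hD0
        linarith
    · simp only [hb, if_neg (show ¬ (ℓ < ℓ ∨ k ≤ r ℓ) by omega)]
      rw [max_eq_right (by omega)]
      refine (sum_Ioc_choose_mul_le k (x ℓ) M D (by rw [hxM]; positivity) hD0 ?_).trans ?_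
      · rw [hxM]
        linarith
      · rw [hxM]
        refine mul_le_mul_of_nonneg_right ?_ hD0
        linarith
  linarith

end MultiHypergraph

/-! ### The theorem -/

theorem mainTheorem5 (K : ℝ) :
    ∃ K₀ : ℝ, 0 < K₀ ∧
      ∀ (V : Type*) [Fintype V] [DecidableEq V] (H : MultiHypergraph V)
        (ℓ : ℕ) (hℓ : 1 ≤ ℓ) (q : ℕ → ℝ) (r : ℕ → ℕ) (C : ℝ),
        r (ℓ + 1) = 1 →
        H.IsSpread ℓ q r →
        (∀ i, 1 ≤ i → i ≤ ℓ → (r i : ℝ) ≤ K * q i * (Fintype.card V : ℝ)) →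
        (∀ i, 1 ≤ i → i < ℓ → H.minEdgeSize < r i → Real.log (r i) ≤ K * (r (i + 1) : ℝ)) →
        (r ℓ : ℝ) ≤ max (H.minEdgeSize : ℝ) (K₀ * Real.log ((ℓ : ℝ) + 1)) →
        K₀ ≤ C →
        C * ∑ i ∈ Finset.Icc 1 ℓ, q i ≤ 1 →
        1 - K₀ * Real.log ((ℓ : ℝ) + 1) /
            (C * ((∑ i ∈ Finset.Icc 1 ℓ, q i) /
              (Finset.Icc 1 ℓ).sup' (Finset.nonempty_Icc.mpr hℓ) q))
          ≤ H.probContainsEdge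
              ⌈C * (∑ i ∈ Finset.Icc 1 ℓ, q i) * (Fintype.card V : ℝ)⌉₊ := by
  -- The losses of the early stages and of the last one contribute 64 each. The term `2|K|` gives `C
  -- * q i * |V| ≥ 2`, as `1 ≤ r i ≤ K * q i * |V|`, so no stage is empty.
  refine ⟨128 + 2 * |K|, by positivity, ?_⟩
  intro V _ _ H ℓ hℓ q r C hr h hrK _ _ hC hCQ
  set Q := ∑ i ∈ Finset.Icc 1 ℓ, q i with hQ
  set M := (Finset.Icc 1 ℓ).sup' (Finset.nonempty_Icc.mpr hℓ) q
  have hM : ∀ i, 1 ≤ i → i ≤ ℓ → q i ≤ M := fun i hi hiℓ =>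
    Finset.le_sup' q (Finset.mem_Icc.2 ⟨hi, hiℓ⟩)
  have hK0 := abs_nonneg K
  have hM0 : 0 < M := (h.q_pos 1 le_rfl hℓ).trans_le (hM 1 le_rfl hℓ)
  have hQ0 : 0 < Q := Finset.sum_pos
    (fun i hi => h.q_pos i (Finset.mem_Icc.1 hi).1 (Finset.mem_Icc.1 hi).2)
    (Finset.nonempty_Icc.mpr hℓ)
  have hC0 : 0 < C := by linarith
  have hlam : 0 ≤ Real.log ((ℓ : ℝ) + 1) :=
    Real.log_nonneg (by linarith [Nat.cast_nonneg (α := ℝ) ℓ])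
  have hg0 : 0 ≤ M / (C * Q) := by positivity
  have hrw : (128 + 2 * |K|) * Real.log ((ℓ : ℝ) + 1) / (C * (Q / M)) =
      (128 + 2 * |K|) * Real.log ((ℓ : ℝ) + 1) * (M / (C * Q)) := by
    field_simp
  have hle : 128 * Real.log ((ℓ : ℝ) + 1) * (M / (C * Q)) ≤
      (128 + 2 * |K|) * Real.log ((ℓ : ℝ) + 1) * (M / (C * Q)) := by
    gcongr
    linarith
  rw [hrw]
  rcases le_or_gt (128 * Real.log ((ℓ : ℝ) + 1) * (M / (C * Q))) 1 with hε | hε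
  · refine le_trans (by linarith) (h.one_sub_le_probContainsEdge hℓ hr hQ.symm hM (by linarith)
      hCQ ?_ hε)
    intro i hi hiℓ
    have hqi := h.q_pos i hi hiℓ
    have h1 : (1 : ℝ) ≤ r i := by exact_mod_cast h.r_pos i hi (by omega)
    have h2 : K * (q i * Fintype.card V) ≤ |K| * (q i * Fintype.card V) := by
      gcongr
      exact le_abs_self K
    have h3 : 2 * |K| * (q i * Fintype.card V) ≤ C * (q i * Fintype.card V) := by
      gcongr
      linarith
    linarith [hrK i hi hiℓ]
  -- The claimed lower bound is negative here.
  · refine le_trans (by linarith) (show (0 : ℝ) ≤ _ from ?_)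
    unfold MultiHypergraph.probContainsEdge
    positivity
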